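/- A base station with $M$ antennas receives $\boldsymbol Y=\sqrt{\rho}\,e^{i\theta}\boldsymbol g_n\boldsymbol\phi^{\mathsf T}+\boldsymbol W\in\mathbb C^{M\times\tau}$, where $\rho>0$, the phase $\theta$ is unknown, $\boldsymbol\phi\in\mathbb C^{\tau}$ is a fixed pilot with $\|\boldsymbol\phi\|=1$ (the same for every beam), the channel $\boldsymbol g_n$ is one of $\boldsymbol g_1,\dots,\boldsymbol g_N\in\mathbb C^M$ with $\|\boldsymbol g_j\|^2=M\beta$ for all $j$, $\beta>0$, and $\boldsymbol W$ has independent $\mathcal{CN}(0,1)$ entries. Let $p(\boldsymbol Y;\boldsymbol g,\vartheta)$ be the density of the received matrix for channel $\boldsymbol g$ and phase $\vartheta$. Let the pairwise error probability $P_{n\to n'}$ be the probability, when the true channel is $\boldsymbol g_n$, that the maximum-likelihood detector strictly prefers $\boldsymbol g_{n'}$, i.e. that $\max_{\vartheta}p(\boldsymbol Y;\boldsymbol g_{n'},\vartheta)>\max_{\vartheta}p(\boldsymbol Y;\boldsymbol g_{n},\vartheta)$. Then, as long as $\boldsymbol g_{n'}$ is not a phase-rotated copy of $\boldsymbol g_n$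 (i.e. $|\boldsymbol g_n^{\mathsf H}\boldsymbol g_{n'}|<M\beta$), $P_{n\to n'}$ strictly decreases when $|\boldsymbol g_n^{\mathsf H}\boldsymbol g_{n'}|$ decreases or when $\sqrt{\rho M\beta}$ increases. Precisely, take two such systems (possibly with different dimensions, beams, pilots and phases) and one pair of beams in each, and mark the quantities of the second system by a tilde. Write $c=|\boldsymbol g_n^{\mathsf H}\boldsymbol g_{n'}|$ for the first pair, $\tilde c$ for the second, and assume $c<M\beta$. Then the pairwise error probability of the second pair is strictly smaller than that of the first in each of the following cases: 1. $\tilde\rho=\rho$, $\tilde M\tilde\beta=M\beta$ and $\tilde c<c$; 2. $\sqrt{\tilde\rho\tilde M\tilde\beta}>\sqrt{\rho M\beta}$, $\tilde c=c$ and $\tilde M\tilde\beta\ge M\beta$; 3. $\tilde c/(\tilde M\tilde\beta)\le c/(M\beta)$ and $\sqrt{\tilde\rho\tilde M\tilde\beta}\ge\sqrt{\rho M\beta}$, with at least one of these two inequalities strict. -/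

import Mathlib

open MeasureTheory ProbabilityTheory

noncomputable section

/-- The standard circularly symmetric complex Gaussian distribution `CN(0, 1)`: real and imaginary
parts are independent real Gaussians of mean `0` and variance `1 / 2`. -/
def stdComplexGaussian : Measure ℂ :=
  ((gaussianReal 0 (1 / 2)).prod (gaussianReal 0 (1 / 2))).map
    (fun p : ℝ × ℝ => (⟨p.1, p.2⟩ : ℂ))

/-- The law of an `M × τ` noise matrix with independent `CN(0, 1)` entries. -/
def noiseLaw (M τ : ℕ) : Measure (Fin M → Fin τ → ℂ) :=
  Measure.pi fun _ => Measure.pi fun _ => stdComplexGaussian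

/-- Reciprocal uplink with a grid of beams and no channel knowledge at the terminal: SNR `ρ`,
large-scale coefficient `β`, unknown phase shift `θ`, beams `g 0, …, g (N - 1)` of common squared
norm `M β`, and one fixed unit-norm pilot `φ` of length `τ`, sent whatever the beam is. -/
structure GridOfBeams (M τ N : ℕ) where
  ρ : ℝ
  β : ℝ
  θ : ℝ
  g : Fin N → EuclideanSpace ℂ (Fin M)
  φ : EuclideanSpace ℂ (Fin τ)
  ρ_pos : 0 < ρ
  β_pos : 0 < β
  norm_g : ∀ n, ‖g n‖ ^ 2 = M * β
  norm_φ : ‖φ‖ ^ 2 = 1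

namespace GridOfBeams

variable {M τ N : ℕ} (S : GridOfBeams M τ N)

/-- The noiseless received matrix `√ρ e^{iϑ} g_n φᵀ` for beam `n` and phase shift `ϑ`. -/
def signal (n : Fin N) (ϑ : ℝ) : Matrix (Fin M) (Fin τ) ℂ :=
  ((Real.sqrt S.ρ : ℂ) * Complex.exp (ϑ * Complex.I)) • Matrix.vecMulVec (S.g n) S.φ

/-- The received matrix `Y = √ρ e^{iθ} g_n φᵀ + W` when the true beam is `n` (and the true phase
shift is `S.θ`). -/
def received (n : Fin N) (W : Fin M → Fin τ → ℂ) : Matrix (Fin M) (Fin τ) ℂ :=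
  S.signal n S.θ + Matrix.of W

/-- The likelihood `p(Y; g_n, ϑ)`: the density at `Y` of the matrix with independent entries
`Y i j ~ CN(signal i j, 1)`. -/
def likelihood (n : Fin N) (ϑ : ℝ) (Y : Matrix (Fin M) (Fin τ) ℂ) : ℝ :=
  (1 / Real.pi ^ (M * τ)) * Real.exp (-∑ i, ∑ j, ‖Y i j - S.signal n ϑ i j‖ ^ 2)

/-- The phase-concentrated likelihood of beam `n`: the likelihood maximized over the phase shift.
The supremum is over a bounded family and is attained at the maximum-likelihood phase estimate. -/
def concentratedLikelihood (n : Fin N) (Y : Matrix (Fin M) (Fin τ) ℂ) : ℝ :=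
  ⨆ ϑ : ℝ, S.likelihood n ϑ Y

/-- The pairwise error probability: the probability, when the true beam is `n`, that the
maximum-likelihood detector prefers beam `n'` to beam `n`. -/
def pairwiseErrorProb (n n' : Fin N) : ℝ :=
  (noiseLaw M τ).real {W | S.concentratedLikelihood n (S.received n W) <
    S.concentratedLikelihood n' (S.received n W)}

/-- The beam correlation `|g_nᴴ g_{n'}|`. -/
def corr (n n' : Fin N) : ℝ := ‖inner ℂ (S.g n) (S.g n')‖

/-- The effective SNR parameter `√(ρ M β)`. -/
def sqrtSNR : ℝ := Real.sqrt (S.ρ * M * S.β)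

end GridOfBeams

end

open scoped ComplexConjugate

noncomputable section

/-! Write `G = M β` and `c` for the beam correlation. Maximizing the likelihood over the phase
leaves the modulus of the matched filter `g_nᴴ Y φ*`; as all beams have the same norm, the error
event is `‖s‖ < ‖t‖` for the filter outputs `s`, `t` of the true and the competing beam. After
harmless rotations their means are `√ρ G` and `√ρ c`. Now `‖s‖² - ‖t‖² = Re ((s - t) conj (s + t))`,
and equal norms make `s - t` and `s + t` uncorrelated, hence independent. So the error probability
is `obtuseProb δ σ` with `δ² = ρ (G - c) / 2` and `σ² = ρ (G + c) / 2` (`pairwiseErrorProb_eq`).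
Here `δ² + σ² = ρ G`, while `δ / σ` depends only on `c / G`.

Two monotonicities remain. `obtuseProb` is symmetric and decreases in each argument when the other
is positive (`obtuseProb_lt_left`). A rotation by `π / 4` turns it into `ricianProb`, with
parameters proportional to `σ - δ` and `σ + δ`, which increases in the first one (`ricianProb_lt`).
`obtuseProb_lt` joins them: equalize the pair at constant sum, then scale it up.

Both monotonicities come from one symmetrization (`measureReal_lt_of_slice`): conditionally on the
real part `X` of a variable of positive mean, the two probabilities differ by an odd function of
`X`, positive for `X > 0`, and a Gaussian of positive mean favours `X` over `-X`. -/

instance isProbabilityMeasure_stdComplexGaussian : IsProbabilityMeasure stdComplexGaussian :=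
  Measure.isProbabilityMeasure_map (by
    apply Measurable.aemeasurable
    exact Complex.measurableEquivRealProd.symm.measurable)

instance isProbabilityMeasure_noiseLaw (M τ : ℕ) : IsProbabilityMeasure (noiseLaw M τ) := by
  unfold noiseLaw; infer_instance

/-! ### Characteristic functions and rotations of complex Gaussians -/

theorem stdComplexGaussian_eq_map :
    stdComplexGaussian = ((gaussianReal 0 (1 / 2)).prod (gaussianReal 0 (1 / 2))).map
      Complex.measurableEquivRealProd.symm := rfl

theorem charFun_stdComplexGaussian (t : ℂ) :
    charFun stdComplexGaussian t = Complex.exp (-((‖t‖ ^ 2 / 4 : ℝ) : ℂ)) := by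
  rw [charFun_apply, stdComplexGaussian_eq_map, integral_map_equiv]
  have h : ∀ p : ℝ × ℝ,
      Complex.exp ((inner ℝ (Complex.measurableEquivRealProd.symm p) t : ℝ) * Complex.I) =
        Complex.exp (t.re * p.1 * Complex.I) * Complex.exp (t.im * p.2 * Complex.I) := by
    intro p
    rw [← Complex.exp_add]
    congr 1
    simp only [Complex.inner, Complex.measurableEquivRealProd, Complex.mul_re, Complex.conj_re,
      Complex.conj_im]
    push_cast
    simp
    ring
  simp_rw [h]
  rw [integral_prod_mul (f := fun x : ℝ => Complex.exp (t.re * x * Complex.I))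
    (g := fun x : ℝ => Complex.exp (t.im * x * Complex.I)), ← charFun_apply_real,
    ← charFun_apply_real, charFun_gaussianReal, charFun_gaussianReal, ← Complex.exp_add]
  congr 1
  rw [← Complex.normSq_eq_norm_sq, Complex.normSq_apply]
  push_cast
  ring

/-- A real-linear functional of a matrix with i.i.d. `CN(0, 1)` entries. -/
theorem integral_exp_inner_noiseLaw {M τ : ℕ} (c : Fin M → Fin τ → ℂ) :
    ∫ W, Complex.exp ((∑ i, ∑ j, inner ℝ (W i j) (c i j) : ℝ) * Complex.I) ∂noiseLaw M τ =
      Complex.exp (-((∑ i, ∑ j, ‖c i j‖ ^ 2 : ℝ) / 4 : ℂ)) := by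
  have h : ∀ W : Fin M → Fin τ → ℂ,
      Complex.exp ((∑ i, ∑ j, inner ℝ (W i j) (c i j) : ℝ) * Complex.I) =
        ∏ i, ∏ j, Complex.exp ((inner ℝ (W i j) (c i j) : ℝ) * Complex.I) := by
    intro W
    simp_rw [← Complex.exp_sum]
    push_cast
    simp_rw [Finset.sum_mul]
  simp_rw [h]
  unfold noiseLaw
  rw [integral_fintype_prod_eq_prod (f := fun i (w : Fin τ → ℂ) =>
    ∏ j, Complex.exp ((inner ℝ (w j) (c i j) : ℝ) * Complex.I))]
  have h2 : ∀ i, ∫ w : Fin τ → ℂ, ∏ j, Complex.exp ((inner ℝ (w j) (c i j) : ℝ) * Complex.I)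
      ∂Measure.pi (fun _ => stdComplexGaussian) =
      ∏ j, Complex.exp (-((‖c i j‖ ^ 2 / 4 : ℝ) : ℂ)) := by
    intro i
    rw [integral_fintype_prod_eq_prod (f := fun j (w : ℂ) =>
      Complex.exp ((inner ℝ w (c i j) : ℝ) * Complex.I))]
    refine Finset.prod_congr rfl fun j _ => ?_
    rw [← charFun_stdComplexGaussian, charFun_apply]
  simp_rw [h2, ← Complex.exp_sum]
  push_cast
  simp_rw [Finset.sum_neg_distrib, Finset.sum_div]

theorem inner_mul_left_eq (p w t : ℂ) : inner ℝ (p * w) t = inner ℝ w (conj p * t) := by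
  simp only [Complex.inner, map_mul]
  congr 1
  ring

theorem norm_add_sq_eq (a b : ℂ) : ‖a + b‖ ^ 2 = ‖a‖ ^ 2 + ‖b‖ ^ 2 + 2 * (a * conj b).re := by
  simp only [← Complex.normSq_eq_norm_sq]
  rw [Complex.normSq_add]

/-- Two orthonormal linear statistics of a matrix with i.i.d. `CN(0, 1)` entries are independent
`CN(0, 1)` variables. -/
theorem map_noiseLaw_eq_prod {M τ : ℕ} (p q : Fin M → Fin τ → ℂ)
    (hp : ∑ i, ∑ j, ‖p i j‖ ^ 2 = 1) (hq : ∑ i, ∑ j, ‖q i j‖ ^ 2 = 1)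
    (hpq : ∑ i, ∑ j, conj (p i j) * q i j = 0) :
    (noiseLaw M τ).map (fun W => (∑ i, ∑ j, p i j * W i j, ∑ i, ∑ j, q i j * W i j)) =
      stdComplexGaussian.prod stdComplexGaussian := by
  have hmeas : Measurable (fun W : Fin M → Fin τ → ℂ =>
      (∑ i, ∑ j, p i j * W i j, ∑ i, ∑ j, q i j * W i j)) := by fun_prop
  have := Measure.isProbabilityMeasure_map (μ := noiseLaw M τ) hmeas.aemeasurable
  rw [← charFun_eq_prod_iff]
  intro t
  obtain ⟨⟨t1, t2⟩⟩ := t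
  rw [charFun_apply, integral_map (by fun_prop) (by fun_prop), integral_map (by fun_prop)
    (by fun_prop), charFun_stdComplexGaussian, charFun_stdComplexGaussian, ← Complex.exp_add]
  have h : ∀ W : Fin M → Fin τ → ℂ,
      inner ℝ (WithLp.toLp 2 (∑ i, ∑ j, p i j * W i j, ∑ i, ∑ j, q i j * W i j))
        (WithLp.toLp 2 (t1, t2)) =
      ∑ i, ∑ j, inner ℝ (W i j) (conj (p i j) * t1 + conj (q i j) * t2) := by
    intro W
    simp only [WithLp.prod_inner_apply, sum_inner, inner_add_right, Finset.sum_add_distrib,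
      inner_mul_left_eq]
  simp_rw [h]
  rw [integral_exp_inner_noiseLaw]
  congr 1
  have key : ∑ i, ∑ j, ‖conj (p i j) * t1 + conj (q i j) * t2‖ ^ 2 = ‖t1‖ ^ 2 + ‖t2‖ ^ 2 := by
    have h3 : ∀ i j, ‖conj (p i j) * t1 + conj (q i j) * t2‖ ^ 2 =
        ‖p i j‖ ^ 2 * ‖t1‖ ^ 2 + ‖q i j‖ ^ 2 * ‖t2‖ ^ 2 +
          2 * (conj (p i j) * q i j * (t1 * conj t2)).re := by
      intro i j
      rw [norm_add_sq_eq, norm_mul, norm_mul, RCLike.norm_conj, RCLike.norm_conj, mul_pow, mul_pow]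
      congr 3
      simp only [map_mul, Complex.conj_conj]
      ring
    simp_rw [h3, Finset.sum_add_distrib, ← Finset.mul_sum, ← Complex.re_sum, ← Finset.sum_mul, hp,
      hq, hpq]
    simp
  rw [key]
  push_cast
  ring

/-- The law of a pair of independent `CN(0, 1)` variables is invariant under the rotation by
`π / 4`. -/
theorem map_prod_stdComplexGaussian_rotation {c : ℝ} (hc : 2 * c ^ 2 = 1) :
    (stdComplexGaussian.prod stdComplexGaussian).map
      (fun z : ℂ × ℂ => ((c : ℂ) * (z.2 - z.1), (c : ℂ) * (z.1 + z.2))) =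
      stdComplexGaussian.prod stdComplexGaussian := by
  have hmeas : Measurable (fun z : ℂ × ℂ => ((c : ℂ) * (z.2 - z.1), (c : ℂ) * (z.1 + z.2))) := by
    fun_prop
  have := Measure.isProbabilityMeasure_map
    (μ := stdComplexGaussian.prod stdComplexGaussian) hmeas.aemeasurable
  rw [← charFun_eq_prod_iff]
  intro t
  obtain ⟨⟨t1, t2⟩⟩ := t
  rw [charFun_apply, integral_map (by fun_prop) (by fun_prop), integral_map (by fun_prop)
    (by fun_prop)]
  have h : ∀ z : ℂ × ℂ,
      Complex.exp ((inner ℝ (WithLp.toLp 2 ((c : ℂ) * (z.2 - z.1), (c : ℂ) * (z.1 + z.2)))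
        (WithLp.toLp 2 (t1, t2)) : ℝ) * Complex.I) =
      Complex.exp ((inner ℝ z.1 (c * (t2 - t1)) : ℝ) * Complex.I) *
        Complex.exp ((inner ℝ z.2 (c * (t1 + t2)) : ℝ) * Complex.I) := by
    intro z
    rw [← Complex.exp_add, ← add_mul, ← Complex.ofReal_add]
    congr 3
    simp only [WithLp.prod_inner_apply, Complex.inner, map_mul, Complex.conj_ofReal, map_sub,
      map_add, ← Complex.add_re]
    congr 1
    ring
  simp_rw [h]
  rw [integral_prod_mul (f := fun z : ℂ => Complex.exp ((inner ℝ z (c * (t2 - t1)) : ℝ) * Complex.I))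
    (g := fun z : ℂ => Complex.exp ((inner ℝ z (c * (t1 + t2)) : ℝ) * Complex.I)),
    ← charFun_apply, ← charFun_apply]
  simp only [charFun_stdComplexGaussian, ← Complex.exp_add]
  congr 1
  have h1 : ‖(c : ℂ) * (t2 - t1)‖ ^ 2 + ‖(c : ℂ) * (t1 + t2)‖ ^ 2 = ‖t1‖ ^ 2 + ‖t2‖ ^ 2 := by
    have := parallelogram_law_with_norm ℝ t1 t2
    rw [norm_mul, norm_mul, norm_sub_rev, mul_pow, mul_pow, Complex.norm_real, Real.norm_eq_abs,
      sq_abs]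
    nlinarith
  rw [← neg_add, ← neg_add, ← Complex.ofReal_add, ← Complex.ofReal_add, ← add_div, h1, add_div]

/-! ### Strict comparison of events by symmetrization -/

instance isOpenPosMeasure_gaussianReal_half :
    (gaussianReal 0 (1 / 2)).IsOpenPosMeasure :=
  (gaussianReal_absolutelyContinuous' 0 (by norm_num)).isOpenPosMeasure

instance isOpenPosMeasure_stdComplexGaussian : stdComplexGaussian.IsOpenPosMeasure := by
  rw [stdComplexGaussian_eq_map]
  exact Complex.equivRealProdCLM.symm.continuous.isOpenPosMeasure_map
    Complex.equivRealProdCLM.symm.surjective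

theorem gaussianPDFReal_lt_of_pos {m x : ℝ} (hm : 0 < m) (hx : 0 < x) :
    gaussianPDFReal 0 (1 / 2) (m + x) < gaussianPDFReal 0 (1 / 2) (x - m) := by
  simp only [gaussianPDFReal_def]
  apply mul_lt_mul_of_pos_left _ (by positivity)
  apply Real.exp_lt_exp.2
  push_cast
  nlinarith [mul_pos hm hx]

/-- The mean of an odd function, positive on the positive reals, of a Gaussian variable with
positive mean. -/
theorem integral_gaussianReal_pos_of_odd {f : ℝ → ℝ} (hf : Measurable f) {C : ℝ}
    (hC : ∀ x, |f x| ≤ C) (hodd : ∀ x, f (-x) = -f x) (hpos : ∀ x, 0 < x → 0 < f x)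
    {m : ℝ} (hm : 0 < m) : 0 < ∫ x, f (m + x) ∂gaussianReal 0 (1 / 2) := by
  set p := gaussianPDFReal 0 (1 / 2) with hp
  have hpi : Integrable p := integrable_gaussianPDFReal _ _
  have hpe : ∀ x, p (-x) = p x := by intro x; simp [hp, gaussianPDFReal_def]
  have e1 : ∫ x, f (m + x) ∂gaussianReal 0 (1 / 2) = ∫ x, p (x - m) * f x := by
    rw [integral_gaussianReal_eq_integral_smul (by norm_num),
      ← integral_sub_right_eq_self _ m]
    simp [hp]
  -- Reflecting `x` gives the integral a second form; the difference of the two forms is twice the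
  -- integral, and its integrand is even and positive off `0`.
  have e2 : ∫ x, p (x - m) * f x = -∫ x, p (m + x) * f x := by
    rw [← integral_neg_eq_self, ← integral_neg]
    congr 1 with x
    rw [hodd, ← hpe, neg_sub, sub_neg_eq_add]
    ring
  have i1 : Integrable fun x => p (x - m) * f x :=
    (hpi.comp_sub_right m).mul_bdd hf.aestronglyMeasurable (c := C)
      (Filter.Eventually.of_forall hC)
  have i2 : Integrable fun x => p (m + x) * f x :=
    (hpi.comp_add_left m).mul_bdd hf.aestronglyMeasurable (c := C)
      (Filter.Eventually.of_forall hC)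
  have e3 : 0 < ∫ x, (p (x - m) * f x - p (m + x) * f x) := by
    have hfz : f 0 = 0 := by have := hodd 0; rw [neg_zero] at this; linarith
    have hgp : ∀ x, 0 < x → 0 < p (x - m) * f x - p (m + x) * f x := fun x hx => by
      have := mul_pos (sub_pos.2 (gaussianPDFReal_lt_of_pos hm hx)) (hpos x hx)
      rwa [sub_mul] at this
    refine (integral_pos_iff_support_of_nonneg ?_ (i1.sub i2)).2 ?_
    rotate_left
    · refine lt_of_lt_of_le ?_ (measure_mono (show Set.Ioi (0 : ℝ) ⊆ _ from
        fun x hx => (hgp x hx).ne'))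
      simp
    · intro x
      rcases lt_trichotomy x 0 with h | h | h
      · have := hgp (-x) (by linarith)
        rw [hodd, show -x - m = -(m + x) by ring, show m + -x = -(x - m) by ring, hpe, hpe] at this
        simp only [Pi.zero_apply, Pi.sub_apply]
        linarith
      · simp [h, hfz]
      · exact (hgp x h).le
  rw [integral_sub i1 i2] at e3
  rw [e1]
  linarith

section slice

variable {Ω : Type*} [MeasurableSpace Ω] (κ : Measure Ω) [IsProbabilityMeasure κ]

/-- The probability that `(X + i y, ω)` lies in `A`, for Gaussian `y` and `ω` of law `κ`. -/
def slice (A : Set (ℂ × Ω)) (X : ℝ) : ℝ :=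
  ((gaussianReal 0 (1 / 2)).prod κ).real {q | ((⟨X, q.1⟩ : ℂ), q.2) ∈ A}

variable {κ}

theorem measurable_complex_mk : Measurable fun p : ℝ × ℝ => (⟨p.1, p.2⟩ : ℂ) :=
  Complex.measurableEquivRealProd.symm.measurable

theorem measurable_slice_map :
    Measurable fun p : ℝ × (ℝ × Ω) => ((⟨p.1, p.2.1⟩ : ℂ), p.2.2) :=
  (measurable_complex_mk.comp (measurable_fst.prodMk measurable_snd.fst)).prodMk
    measurable_snd.snd

theorem measurable_slice {A : Set (ℂ × Ω)} (hA : MeasurableSet A) : Measurable (slice κ A) :=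
  (measurable_measure_prodMk_left (measurable_slice_map hA)).ennreal_toReal

theorem slice_mem_Icc (A : Set (ℂ × Ω)) (X : ℝ) : slice κ A X ∈ Set.Icc 0 1 :=
  ⟨measureReal_nonneg, measureReal_le_one⟩

theorem measureReal_prod_eq_integral_slice {A : Set (ℂ × Ω)} (hA : MeasurableSet A) (m : ℝ) :
    (stdComplexGaussian.prod κ).real {z | ((m : ℂ) + z.1, z.2) ∈ A} =
      ∫ x, slice κ A (m + x) ∂gaussianReal 0 (1 / 2) := by
  have hB : MeasurableSet {z : ℂ × Ω | ((m : ℂ) + z.1, z.2) ∈ A} :=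
    (show Measurable fun z : ℂ × Ω => ((m : ℂ) + z.1, z.2) by fun_prop) hA
  have e1 : stdComplexGaussian.prod κ =
      ((gaussianReal 0 (1 / 2)).prod ((gaussianReal 0 (1 / 2)).prod κ)).map
        (fun p => ((⟨p.1, p.2.1⟩ : ℂ), p.2.2)) := by
    have h := Measure.map_prod_map ((gaussianReal 0 (1 / 2)).prod (gaussianReal 0 (1 / 2))) κ
      measurable_complex_mk measurable_id
    rw [Measure.map_id] at h
    rw [stdComplexGaussian, h, ← (measurePreserving_prodAssoc _ _ _).symm.map_eq,
      Measure.map_map (by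
        exact (measurable_complex_mk.comp measurable_fst).prodMk measurable_snd)
        (MeasurableEquiv.measurable _)]
    rfl
  rw [measureReal_def, e1, Measure.map_apply measurable_slice_map hB,
    Measure.prod_apply (measurable_slice_map hB), integral_eq_lintegral_of_nonneg_ae
      (Filter.Eventually.of_forall fun x => (slice_mem_Icc A _).1)
      ((measurable_slice hA).comp (measurable_const_add m)).aestronglyMeasurable]
  congr 1
  refine lintegral_congr fun x => ?_
  rw [slice, ofReal_measureReal]
  congr 1
  ext q
  simp only [Set.mem_preimage, Set.mem_ofPred_eq]
  rw [show (m : ℂ) + ⟨x, q.1⟩ = ⟨m + x, q.1⟩ by apply Complex.ext <;> simp]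

/-- Comparison of two events by symmetrization of the real part of the Gaussian variable. -/
theorem measureReal_lt_of_slice {A B : Set (ℂ × Ω)} (hA : MeasurableSet A) (hB : MeasurableSet B)
    (hodd : ∀ X, slice κ A (-X) - slice κ B (-X) = -(slice κ A X - slice κ B X))
    (hpos : ∀ X, 0 < X → slice κ B X < slice κ A X) {m : ℝ} (hm : 0 < m) :
    (stdComplexGaussian.prod κ).real {z | ((m : ℂ) + z.1, z.2) ∈ B} <
      (stdComplexGaussian.prod κ).real {z | ((m : ℂ) + z.1, z.2) ∈ A} := by
  rw [measureReal_prod_eq_integral_slice hA, measureReal_prod_eq_integral_slice hB, ← sub_pos,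
    ← integral_sub]
  · refine integral_gaussianReal_pos_of_odd (f := fun X => slice κ A X - slice κ B X) (C := 1)
      ((measurable_slice hA).sub (measurable_slice hB)) (fun X => ?_) hodd
      (fun X hX => sub_pos.2 (hpos X hX)) hm
    have h1 := slice_mem_Icc (κ := κ) A X
    have h2 := slice_mem_Icc (κ := κ) B X
    exact abs_le.2 ⟨by linarith [h1.1, h2.2], by linarith [h1.2, h2.1]⟩
  all_goals
    refine Integrable.of_bound (C := 1) ?_ (Filter.Eventually.of_forall fun x => ?_)
    · exact ((measurable_slice (by assumption)).comp (measurable_const_add m)).aestronglyMeasurable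
    · rw [Real.norm_eq_abs, abs_of_nonneg (slice_mem_Icc _ _).1]
      exact (slice_mem_Icc _ _).2

/-- Inclusion gives the weak inequality; a nonempty open set in the gap has positive mass and makes
it strict. -/
theorem slice_lt_slice [TopologicalSpace Ω] [κ.IsOpenPosMeasure] {A B : Set (ℂ × Ω)}
    (hB : MeasurableSet B) {X : ℝ} {U : Set (ℝ × Ω)} (hU : IsOpen U) (hUne : U.Nonempty)
    (hBA : ∀ q : ℝ × Ω, ((⟨X, q.1⟩ : ℂ), q.2) ∈ B → ((⟨X, q.1⟩ : ℂ), q.2) ∈ A)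
    (hUA : ∀ q ∈ U, ((⟨X, q.1⟩ : ℂ), q.2) ∈ A) (hUB : ∀ q ∈ U, ((⟨X, q.1⟩ : ℂ), q.2) ∉ B) :
    slice κ B X < slice κ A X := by
  set P := (gaussianReal 0 (1 / 2)).prod κ
  have hpos : 0 < P.real U := ENNReal.toReal_pos (hU.measure_pos P hUne).ne' (by finiteness)
  have hm : MeasurableSet {q : ℝ × Ω | ((⟨X, q.1⟩ : ℂ), q.2) ∈ B} :=
    (measurable_slice_map.comp measurable_prodMk_left) hB
  have hd : Disjoint U {q : ℝ × Ω | ((⟨X, q.1⟩ : ℂ), q.2) ∈ B} :=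
    Set.disjoint_left.2 fun q hq => hUB q hq
  calc slice κ B X < P.real U + slice κ B X := by linarith
    _ = P.real (U ∪ {q | ((⟨X, q.1⟩ : ℂ), q.2) ∈ B}) := (measureReal_union hd hm).symm
    _ ≤ slice κ A X := measureReal_mono (Set.union_subset hUA hBA)

end slice

/-! ### Comparison of two Rician variables -/

/-- The probability that a Rician variable of parameter `a` exceeds an independent one of
parameter `b`. -/
def ricianProb (a b : ℝ) : ℝ :=
  (stdComplexGaussian.prod stdComplexGaussian).real {z | ‖(b : ℂ) + z.2‖ < ‖(a : ℂ) + z.1‖}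

theorem ricianProb_lt {a a' b : ℝ} (ha : 0 ≤ a) (haa : a < a') :
    ricianProb a b < ricianProb a' b := by
  -- Centring at the midpoint `m` makes the two events mirror images: reflecting the real part
  -- exchanges the offsets `d` and `-d`.
  obtain ⟨m, hm, d, hd, rfl, rfl⟩ : ∃ m > 0, ∃ d > 0, a = m - d ∧ a' = m + d :=
    ⟨(a' + a) / 2, by linarith, (a' - a) / 2, by linarith, by ring, by ring⟩
  have hmeas : ∀ e : ℝ, MeasurableSet {z : ℂ × ℂ | ‖(b : ℂ) + z.2‖ < ‖z.1 + (e : ℂ)‖} :=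
    fun e => measurableSet_lt (by fun_prop) (by fun_prop)
  have hset : ∀ e : ℝ, ricianProb (m + e) b = (stdComplexGaussian.prod stdComplexGaussian).real
      {z | ((m : ℂ) + z.1, z.2) ∈ {z : ℂ × ℂ | ‖(b : ℂ) + z.2‖ < ‖z.1 + (e : ℂ)‖}} := by
    intro e
    rw [ricianProb]
    congr 1
    ext z
    simp only [Set.mem_ofPred_eq]
    rw [Complex.ofReal_add, add_right_comm]
  have hneg : ∀ e X : ℝ,
      slice stdComplexGaussian {z : ℂ × ℂ | ‖(b : ℂ) + z.2‖ < ‖z.1 + (e : ℂ)‖} (-X) =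
      slice stdComplexGaussian {z : ℂ × ℂ | ‖(b : ℂ) + z.2‖ < ‖z.1 + ((-e : ℝ) : ℂ)‖} X := by
    intro e X
    unfold slice
    congr 1
    ext q
    simp only [Set.mem_ofPred_eq]
    have : ‖(⟨-X, q.1⟩ : ℂ) + (e : ℂ)‖ = ‖(⟨X, q.1⟩ : ℂ) + ((-e : ℝ) : ℂ)‖ := by
      rw [← sq_eq_sq₀ (norm_nonneg _) (norm_nonneg _), ← Complex.normSq_eq_norm_sq,
        ← Complex.normSq_eq_norm_sq]
      simp [Complex.normSq_apply]
      ring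
    rw [this]
  rw [sub_eq_add_neg, hset, hset]
  refine measureReal_lt_of_slice (hmeas d) (hmeas (-d)) (fun X => ?_) (fun X hX => ?_) hm
  · rw [hneg, hneg, neg_neg]; ring
  · have hlt : ∀ y : ℝ, ‖(⟨X, y⟩ : ℂ) + ((-d : ℝ) : ℂ)‖ < ‖(⟨X, y⟩ : ℂ) + (d : ℂ)‖ := by
      intro y
      rw [← sq_lt_sq₀ (norm_nonneg _) (norm_nonneg _), ← Complex.normSq_eq_norm_sq,
        ← Complex.normSq_eq_norm_sq]
      simp [Complex.normSq_apply]
      nlinarith [mul_pos hX hd]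
    have hc : ∀ e : ℝ, Continuous fun q : ℝ × ℂ => ‖(⟨X, q.1⟩ : ℂ) + (e : ℂ)‖ := by
      intro e
      have : Continuous fun q : ℝ × ℂ => (⟨X, q.1⟩ : ℂ) :=
        Complex.equivRealProdCLM.symm.continuous.comp
          (continuous_const.prodMk continuous_fst : Continuous fun q : ℝ × ℂ => (X, q.1))
      fun_prop
    refine slice_lt_slice (hmeas _) (U := {q : ℝ × ℂ | ‖(⟨X, q.1⟩ : ℂ) + ((-d : ℝ) : ℂ)‖ <
        ‖(b : ℂ) + q.2‖} ∩ {q | ‖(b : ℂ) + q.2‖ < ‖(⟨X, q.1⟩ : ℂ) + (d : ℂ)‖})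
      ((isOpen_lt (hc _) (by fun_prop)).inter (isOpen_lt (by fun_prop) (hc _)))
      ?_ (fun q hq => lt_trans hq (hlt _)) (fun q hq => hq.2)
      (fun q hq h => lt_asymm (a := ‖(b : ℂ) + q.2‖) h hq.1)
    obtain ⟨r, hr1, hr2⟩ := exists_between (hlt 0)
    have hr : ‖(b : ℂ) + ((r : ℂ) - b)‖ = r := by
      rw [add_sub_cancel, Complex.norm_real, Real.norm_eq_abs,
        abs_of_nonneg ((norm_nonneg _).trans hr1.le)]
    exact ⟨(0, (r : ℂ) - b), by simpa only [Set.mem_ofPred_eq, hr] using hr1,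
      by simpa only [Set.mem_ofPred_eq, hr] using hr2⟩

/-! ### Obtuse angle between two Gaussian variables -/

/-- The probability that independent `CN(δ, 1)` and `CN(σ, 1)` variables form an obtuse angle. -/
def obtuseProb (δ σ : ℝ) : ℝ :=
  (stdComplexGaussian.prod stdComplexGaussian).real
    {z | (((δ : ℂ) + z.1) * conj ((σ : ℂ) + z.2)).re < 0}

theorem obtuseProb_comm (δ σ : ℝ) : obtuseProb δ σ = obtuseProb σ δ := by
  have hs := Measure.prod_swap (μ := stdComplexGaussian) (ν := stdComplexGaussian)
  unfold obtuseProb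
  conv_lhs => rw [← hs]
  rw [map_measureReal_apply measurable_swap (measurableSet_lt (by fun_prop) (by fun_prop))]
  congr 1
  ext z
  simp only [Set.mem_preimage, Set.mem_ofPred_eq, Prod.fst_swap, Prod.snd_swap]
  simp only [Complex.mul_re, Complex.conj_re, Complex.conj_im]
  constructor <;> intro h <;> linarith

/-- Polarization: twice `Re (u conj v)` is the difference of the squared moduli of `c (u + v)` and
`c (v - u)`, and the rotation preserves the noise law. -/
theorem obtuseProb_eq_ricianProb {c : ℝ} (hc : 2 * c ^ 2 = 1) (δ σ : ℝ) :
    obtuseProb δ σ = ricianProb (c * (σ - δ)) (c * (σ + δ)) := by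
  unfold obtuseProb ricianProb
  conv_lhs => rw [← map_prod_stdComplexGaussian_rotation hc]
  rw [map_measureReal_apply (by fun_prop) (measurableSet_lt (by fun_prop) (by fun_prop))]
  congr 1
  ext z
  simp only [Set.mem_preimage, Set.mem_ofPred_eq]
  rw [← sq_lt_sq₀ (norm_nonneg _) (norm_nonneg _), ← Complex.normSq_eq_norm_sq,
    ← Complex.normSq_eq_norm_sq, Complex.normSq_apply, Complex.normSq_apply]
  simp only [Complex.mul_re, Complex.conj_re, Complex.conj_im, Complex.add_re, Complex.add_im,
    Complex.mul_im, Complex.ofReal_re, Complex.ofReal_im, Complex.sub_re, Complex.sub_im]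
  have e : ∀ x1 y1 x2 y2 : ℝ, (c * (σ + δ) + x2) ^ 2 + y2 ^ 2 - (c * (σ - δ) + x1) ^ 2 - y1 ^ 2 =
      2 * ((δ + c * (x2 - x1)) * (σ + c * (x1 + x2)) + (c * (y2 - y1)) * (c * (y1 + y2))) := by
    intro x1 y1 x2 y2
    linear_combination (2 * σ * δ - (y2 ^ 2 - y1 ^ 2) - (x2 ^ 2 - x1 ^ 2)) * hc
  have := e z.1.re z.1.im z.2.re z.2.im
  constructor <;> intro h <;> nlinarith

theorem measure_line_eq_zero {X : ℝ} (hX : X ≠ 0) (δ y : ℝ) :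
    stdComplexGaussian {u | (((δ : ℂ) + u) * conj (⟨X, y⟩ : ℂ)).re = 0} = 0 := by
  have hm : MeasurableSet {u : ℂ | (((δ : ℂ) + u) * conj (⟨X, y⟩ : ℂ)).re = 0} :=
    (show Measurable fun u : ℂ => (((δ : ℂ) + u) * conj (⟨X, y⟩ : ℂ)).re by fun_prop)
      (measurableSet_singleton 0)
  have := nullSingletonClass_gaussianReal (μ := 0) (v := 1 / 2) (by norm_num)
  rw [stdComplexGaussian, Measure.map_apply measurable_complex_mk hm,
    Measure.prod_apply_symm (measurable_complex_mk hm), lintegral_eq_zero_iff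
      (measurable_measure_prodMk_right (measurable_complex_mk hm))]
  refine Filter.Eventually.of_forall fun v => ?_
  refine measure_mono_null (t := {-(v * y) / X - δ}) (fun x hx => ?_) (measure_singleton _)
  simp only [Set.mem_preimage, Set.mem_ofPred_eq, Complex.mul_re, Complex.conj_re, Complex.conj_im,
    Complex.add_re, Complex.add_im, Complex.ofReal_re, Complex.ofReal_im] at hx
  rw [Set.mem_singleton_iff, eq_sub_iff_add_eq, eq_div_iff hX]
  linarith

/-- Changing the sign of the whole second vector exchanges obtuse and acute angles. The imaginary
part is symmetric, so only `X` is visibly reflected; right angles are negligible when `X ≠ 0`. -/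
theorem slice_obtuse_neg (δ : ℝ) {X : ℝ} (hX : X ≠ 0) :
    slice stdComplexGaussian {z : ℂ × ℂ | (((δ : ℂ) + z.2) * conj z.1).re < 0} (-X) =
      1 - slice stdComplexGaussian {z : ℂ × ℂ | (((δ : ℂ) + z.2) * conj z.1).re < 0} X := by
  have hA : MeasurableSet {z : ℂ × ℂ | (((δ : ℂ) + z.2) * conj z.1).re < 0} :=
    measurableSet_lt (by fun_prop) (by fun_prop)
  have hm : ∀ X, MeasurableSet {q : ℝ × ℂ | (((δ : ℂ) + q.2) * conj (⟨X, q.1⟩ : ℂ)).re < 0} :=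
    fun X => (measurable_slice_map.comp measurable_prodMk_left) hA
  unfold slice
  simp only [Set.mem_ofPred_eq]
  rw [← probReal_compl_eq_one_sub (hm X)]
  have hneg : ((gaussianReal 0 (1 / 2)).prod stdComplexGaussian).map (Prod.map (fun x => -x) id) =
      (gaussianReal 0 (1 / 2)).prod stdComplexGaussian := by
    rw [← Measure.map_prod_map _ _ measurable_neg measurable_id, Measure.map_id,
      gaussianReal_map_neg, neg_zero]
  conv_lhs => rw [← hneg]
  rw [map_measureReal_apply (by fun_prop) (hm _)]
  refine measureReal_congr (Filter.eventuallyEq_set.2 ?_)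
  have hnull : ∀ᵐ q ∂(gaussianReal 0 (1 / 2)).prod stdComplexGaussian,
      (((δ : ℂ) + q.2) * conj (⟨X, q.1⟩ : ℂ)).re ≠ 0 := by
    have hm0 : MeasurableSet {q : ℝ × ℂ | (((δ : ℂ) + q.2) * conj (⟨X, q.1⟩ : ℂ)).re = 0} :=
      (measurable_slice_map.comp measurable_prodMk_left)
        ((show Measurable fun z : ℂ × ℂ => (((δ : ℂ) + z.2) * conj z.1).re by fun_prop)
          (measurableSet_singleton 0))
    rw [ae_iff]
    simp only [ne_eq, not_not]
    rw [Measure.measure_prod_null hm0]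
    exact Filter.Eventually.of_forall fun y => measure_line_eq_zero hX δ y
  filter_upwards [hnull] with q hq
  simp only [Set.mem_preimage, Set.mem_ofPred_eq, Prod.map, id, Set.mem_compl_iff]
  simp only [Complex.mul_re, Complex.conj_re, Complex.conj_im, Complex.add_re, Complex.add_im,
    Complex.ofReal_re, Complex.ofReal_im] at hq ⊢
  rw [not_lt]
  constructor <;> intro h
  · linarith
  · have := lt_of_le_of_ne h (Ne.symm hq)
    linarith

theorem obtuseProb_lt_left {δ δ' σ : ℝ} (hδ : δ < δ') (hσ : 0 < σ) :
    obtuseProb δ' σ < obtuseProb δ σ := by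
  have hA : ∀ δ : ℝ, MeasurableSet {z : ℂ × ℂ | (((δ : ℂ) + z.2) * conj z.1).re < 0} :=
    fun δ => measurableSet_lt (by fun_prop) (by fun_prop)
  have hset : ∀ δ, obtuseProb δ σ = (stdComplexGaussian.prod stdComplexGaussian).real
      {z | ((σ : ℂ) + z.1, z.2) ∈ {z : ℂ × ℂ | (((δ : ℂ) + z.2) * conj z.1).re < 0}} := by
    intro δ
    rw [obtuseProb_comm]
    unfold obtuseProb
    congr 1
    ext z
    simp only [Set.mem_ofPred_eq, Complex.mul_re, Complex.conj_re, Complex.conj_im]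
    constructor <;> intro h <;> linarith
  rw [hset, hset]
  refine measureReal_lt_of_slice (hA δ) (hA δ') (fun X => ?_) (fun X hX => ?_) hσ
  -- At `X = 0` right angles may not be discarded uniformly in the argument above, but there `δ`
  -- drops out of the condition.
  · by_cases hX : X = 0
    · subst hX
      have : slice stdComplexGaussian {z : ℂ × ℂ | (((δ : ℂ) + z.2) * conj z.1).re < 0} 0 =
        slice stdComplexGaussian {z : ℂ × ℂ | (((δ' : ℂ) + z.2) * conj z.1).re < 0} 0 := by
        simp [slice]
      rw [neg_zero, this]; ring
    · rw [slice_obtuse_neg δ hX, slice_obtuse_neg δ' hX]; ring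
  · have hre : ∀ (δ : ℝ) (q : ℝ × ℂ), (((δ : ℂ) + q.2) * conj (⟨X, q.1⟩ : ℂ)).re =
        (δ + q.2.re) * X + q.2.im * q.1 := by
      intro δ q; simp
    have hlt := mul_lt_mul_of_pos_right hδ hX
    refine slice_lt_slice (hA δ') (U := {q : ℝ × ℂ | (δ + q.2.re) * X + q.2.im * q.1 < 0} ∩
        {q | 0 < (δ' + q.2.re) * X + q.2.im * q.1})
      ((isOpen_lt (by fun_prop) (by fun_prop)).inter (isOpen_lt (by fun_prop) (by fun_prop)))
      -- This noise value puts the two shifted real parts on opposite sides of `0`.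
      ⟨(0, ((-(δ + δ') / 2 : ℝ) : ℂ)), ?_, ?_⟩ ?_ ?_ ?_
    · simp only [Set.mem_ofPred_eq, Complex.ofReal_re]; nlinarith
    · simp only [Set.mem_ofPred_eq, Complex.ofReal_re]; nlinarith
    · intro q hq
      simp only [Set.mem_ofPred_eq, hre] at hq ⊢
      nlinarith
    · intro q hq
      simp only [Set.mem_ofPred_eq, hre] at hq ⊢
      exact hq.1
    · intro q hq
      simp only [Set.mem_ofPred_eq, hre] at hq ⊢
      exact not_lt.2 hq.2.le

theorem obtuseProb_mul_lt {δ σ t : ℝ} (hδ : 0 < δ) (hσ : 0 < σ) (ht : t < 1) (ht0 : 0 < t) :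
    obtuseProb δ σ < obtuseProb (t * δ) (t * σ) :=
  calc obtuseProb δ σ < obtuseProb (t * δ) σ := obtuseProb_lt_left (by nlinarith) hσ
    _ = obtuseProb σ (t * δ) := obtuseProb_comm _ _
    _ < obtuseProb (t * σ) (t * δ) := obtuseProb_lt_left (by nlinarith) (by positivity)
    _ = obtuseProb (t * δ) (t * σ) := obtuseProb_comm _ _

theorem obtuseProb_lt {δ σ δ' σ' : ℝ} (hδ : 0 < δ) (hσ : δ ≤ σ) (hδ' : 0 < δ') (hσ' : δ' ≤ σ')
    (hr : σ' * δ ≤ σ * δ') (hs : δ ^ 2 + σ ^ 2 ≤ δ' ^ 2 + σ' ^ 2)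
    (h : σ' * δ < σ * δ' ∨ δ ^ 2 + σ ^ 2 < δ' ^ 2 + σ' ^ 2) :
    obtuseProb δ' σ' < obtuseProb δ σ := by
  obtain ⟨c, hc0, hc⟩ : ∃ c : ℝ, 0 < c ∧ 2 * c ^ 2 = 1 :=
    ⟨√(1 / 2), by positivity, by rw [Real.sq_sqrt (by norm_num)]; norm_num⟩
  -- The intermediate pair `(t δ', t σ')` has the ratio of the target and the sum of the source.
  obtain ⟨t, ht0, ht⟩ : ∃ t : ℝ, 0 < t ∧ t * δ' + t * σ' = δ + σ :=
    ⟨(δ + σ) / (δ' + σ'), div_pos (by linarith) (by linarith),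
      by rw [← mul_add, div_mul_cancel₀ _ (by linarith)]⟩
  have hp : δ' + σ' > 0 := by linarith
  -- Hence the ratio hypothesis decides the sign of `t δ' - δ`.
  have key : (t * δ' - δ) * (δ' + σ') = σ * δ' - σ' * δ := by linear_combination δ' * ht
  have h1 : δ ≤ t * δ' := by
    by_contra hcon
    nlinarith
  have h1' : σ' * δ < σ * δ' → δ < t * δ' := by
    intro hlt
    by_contra hcon
    nlinarith
  have hnn : t * δ' ≤ t * σ' := by gcongr
  -- At equal sums, the more balanced pair has the smaller sum of squares; with `hs` this forces `t
  -- ≤ 1`.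
  have hsum : t ^ 2 * (δ' ^ 2 + σ' ^ 2) ≤ δ ^ 2 + σ ^ 2 := by nlinarith
  have ht1 : t ≤ 1 := by
    by_contra hcon
    push Not at hcon
    have h1t : 1 < t ^ 2 := one_lt_pow₀ hcon two_ne_zero
    nlinarith [sq_nonneg σ', mul_pos hδ' hδ',
      mul_lt_mul_of_pos_right h1t (show 0 < δ' ^ 2 + σ' ^ 2 by positivity)]
  have step1 : obtuseProb (t * δ') (t * σ') ≤ obtuseProb δ σ ∧
      (δ < t * δ' → obtuseProb (t * δ') (t * σ') < obtuseProb δ σ) := by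
    have hlt : δ < t * δ' → obtuseProb (t * δ') (t * σ') < obtuseProb δ σ := by
      intro hlt
      rw [obtuseProb_eq_ricianProb hc, obtuseProb_eq_ricianProb hc,
        show t * σ' + t * δ' = σ + δ by linarith]
      apply ricianProb_lt
      · exact mul_nonneg hc0.le (by linarith)
      · exact mul_lt_mul_of_pos_left (by linarith) hc0
    refine ⟨?_, hlt⟩
    rcases h1.lt_or_eq with h | h
    · exact (hlt h).le
    · rw [← h, show t * σ' = σ by linarith]
  have step2 : t < 1 → obtuseProb δ' σ' < obtuseProb (t * δ') (t * σ') :=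
    fun h => obtuseProb_mul_lt hδ' (by linarith) h ht0
  rcases ht1.lt_or_eq with hlt | rfl
  · exact (step2 hlt).trans_le step1.1
  · simp only [one_mul] at *
    apply step1.2
    rcases h with h | h
    · exact h1' h
    · linarith

/-! ### Matched filters and reduction to an obtuse angle -/

theorem sum_sum_norm_sq_mul {ι κ : Type*} [Fintype ι] [Fintype κ] (a : ι → ℂ) (b : κ → ℂ) :
    ∑ i, ∑ j, ‖a i * b j‖ ^ 2 = (∑ i, ‖a i‖ ^ 2) * ∑ j, ‖b j‖ ^ 2 := by
  simp_rw [norm_mul, mul_pow, Finset.sum_mul_sum]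

theorem sum_sum_conj_mul {ι κ : Type*} [Fintype ι] [Fintype κ] (a c : ι → ℂ) (b : κ → ℂ) :
    ∑ i, ∑ j, conj (a i * b j) * (c i * b j) =
      (∑ i, conj (a i) * c i) * ((∑ j, ‖b j‖ ^ 2 : ℝ) : ℂ) := by
  push_cast
  simp_rw [Finset.sum_mul_sum, ← Complex.conj_mul', map_mul]
  refine Finset.sum_congr rfl fun i _ => Finset.sum_congr rfl fun j _ => ?_
  ring

theorem exp_neg_arg_mul_self (z : ℂ) : Complex.exp (-z.arg * Complex.I) * z = ‖z‖ := by
  have h := Complex.norm_mul_exp_arg_mul_I z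
  calc Complex.exp (-z.arg * Complex.I) * z
      = Complex.exp (-z.arg * Complex.I) * (‖z‖ * Complex.exp (z.arg * Complex.I)) := by rw [h]
    _ = ‖z‖ := by rw [mul_left_comm, ← Complex.exp_add, neg_mul, neg_add_cancel]; simp

namespace GridOfBeams

variable {M τ N : ℕ} (S : GridOfBeams M τ N)

/-- The correlation `g_nᴴ Y φ*` of a matrix with the beam `n` and the pilot. -/
def matchedFilter (n : Fin N) (Y : Matrix (Fin M) (Fin τ) ℂ) : ℂ :=
  ∑ i, ∑ j, conj (S.g n i * S.φ j) * Y i j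

theorem sum_norm_sq_g (n : Fin N) : ∑ i, ‖S.g n i‖ ^ 2 = M * S.β := by
  rw [← S.norm_g n, EuclideanSpace.norm_sq_eq]

theorem sum_norm_sq_φ : ∑ j, ‖S.φ j‖ ^ 2 = 1 := by
  rw [← S.norm_φ, EuclideanSpace.norm_sq_eq]

theorem signal_apply (n : Fin N) (ϑ : ℝ) (i : Fin M) (j : Fin τ) :
    S.signal n ϑ i j =
      ((Real.sqrt S.ρ : ℂ) * Complex.exp (ϑ * Complex.I)) * (S.g n i * S.φ j) := rfl

theorem sum_norm_sq_sub_signal (n : Fin N) (ϑ : ℝ) (Y : Matrix (Fin M) (Fin τ) ℂ) :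
    ∑ i, ∑ j, ‖Y i j - S.signal n ϑ i j‖ ^ 2 = ∑ i, ∑ j, ‖Y i j‖ ^ 2 + S.ρ * (M * S.β) -
      2 * (√S.ρ * (Complex.exp (-ϑ * Complex.I) * S.matchedFilter n Y).re) := by
  have h : ∀ i j, ‖Y i j - S.signal n ϑ i j‖ ^ 2 = ‖Y i j‖ ^ 2 + S.ρ * ‖S.g n i * S.φ j‖ ^ 2 -
      2 * (√S.ρ * (Complex.exp (-ϑ * Complex.I) * (conj (S.g n i * S.φ j) * Y i j)).re) := by
    intro i j
    have hc : Y i j * conj (-S.signal n ϑ i j) = ((-√S.ρ : ℝ) : ℂ) *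
        (Complex.exp (-ϑ * Complex.I) * (conj (S.g n i * S.φ j) * Y i j)) := by
      rw [signal_apply, map_neg, map_mul, map_mul, Complex.conj_ofReal, ← Complex.exp_conj]
      simp only [map_mul, Complex.conj_ofReal, Complex.conj_I]
      push_cast
      ring_nf
    rw [sub_eq_add_neg, norm_add_sq_eq, norm_neg, hc, signal_apply, norm_mul, norm_mul,
      Complex.norm_exp_ofReal_mul_I, Complex.norm_real, mul_one, mul_pow, Real.norm_eq_abs, sq_abs,
      Real.sq_sqrt S.ρ_pos.le, Complex.re_ofReal_mul]
    ring
  simp_rw [h, Finset.sum_sub_distrib, Finset.sum_add_distrib, ← Finset.mul_sum, ← Complex.re_sum,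
    ← Finset.mul_sum]
  rw [sum_sum_norm_sq_mul, S.sum_norm_sq_g, S.sum_norm_sq_φ, mul_one, matchedFilter]

/-- The phase enters only through the real part of a rotated matched filter, which is largest when
the rotation cancels its argument. -/
theorem concentratedLikelihood_eq (n : Fin N) (Y : Matrix (Fin M) (Fin τ) ℂ) :
    S.concentratedLikelihood n Y = (1 / Real.pi ^ (M * τ)) *
      Real.exp (-(∑ i, ∑ j, ‖Y i j‖ ^ 2 + S.ρ * (M * S.β)) + 2 * (√S.ρ * ‖S.matchedFilter n Y‖)) := by
  have hl : ∀ ϑ, S.likelihood n ϑ Y = (1 / Real.pi ^ (M * τ)) *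
      Real.exp (-(∑ i, ∑ j, ‖Y i j‖ ^ 2 + S.ρ * (M * S.β)) +
        2 * (√S.ρ * (Complex.exp (-ϑ * Complex.I) * S.matchedFilter n Y).re)) := by
    intro ϑ
    rw [likelihood, sum_norm_sq_sub_signal, neg_sub, sub_eq_neg_add]
  refine IsLUB.ciSup_eq (IsGreatest.isLUB ⟨⟨(S.matchedFilter n Y).arg, ?_⟩, ?_⟩)
  · simp only [hl]
    congr 5
    rw [exp_neg_arg_mul_self, Complex.ofReal_re]
  · rintro _ ⟨ϑ, rfl⟩
    simp only [hl]
    gcongr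
    refine (Complex.re_le_norm _).trans_eq ?_
    rw [norm_mul, ← Complex.ofReal_neg, Complex.norm_exp_ofReal_mul_I, one_mul]

theorem concentratedLikelihood_lt_iff (n n' : Fin N) (Y : Matrix (Fin M) (Fin τ) ℂ) :
    S.concentratedLikelihood n Y < S.concentratedLikelihood n' Y ↔
      ‖S.matchedFilter n Y‖ < ‖S.matchedFilter n' Y‖ := by
  have h : 0 < √S.ρ := Real.sqrt_pos.2 S.ρ_pos
  rw [concentratedLikelihood_eq, concentratedLikelihood_eq,
    mul_lt_mul_iff_right₀ (by positivity), Real.exp_lt_exp, add_lt_add_iff_left,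
    mul_lt_mul_iff_right₀ two_pos, mul_lt_mul_iff_right₀ h]

theorem matchedFilter_received (n n' : Fin N) (W : Fin M → Fin τ → ℂ) :
    S.matchedFilter n' (S.received n W) =
      √S.ρ * Complex.exp (S.θ * Complex.I) * inner ℂ (S.g n') (S.g n) +
        ∑ i, ∑ j, conj (S.g n' i * S.φ j) * W i j := by
  have h : ∀ i j, conj (S.g n' i * S.φ j) * S.received n W i j =
      √S.ρ * Complex.exp (S.θ * Complex.I) * (conj (S.g n' i * S.φ j) * (S.g n i * S.φ j)) +
        conj (S.g n' i * S.φ j) * W i j := by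
    intro i j
    rw [received, Matrix.add_apply, signal_apply, Matrix.of_apply]
    ring
  simp_rw [matchedFilter, h, Finset.sum_add_distrib, ← Finset.mul_sum]
  rw [sum_sum_conj_mul, S.sum_norm_sq_φ, Complex.ofReal_one, mul_one, PiLp.inner_apply]
  simp_rw [RCLike.inner_apply, mul_comm]

theorem pairwiseErrorProb_eq (n n' : Fin N) (h : S.corr n n' < M * S.β) :
    S.pairwiseErrorProb n n' = obtuseProb (√(S.ρ * (M * S.β - S.corr n n') / 2))
      (√(S.ρ * (M * S.β + S.corr n n') / 2)) := by
  set G : ℝ := M * S.β with hG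
  set c := S.corr n n' with hc
  have hc0 : 0 ≤ c := norm_nonneg _
  -- Rotating the competing beam by `ω` makes the correlation real; with equal norms, the sum and
  -- the difference of the beams are then orthogonal.
  obtain ⟨ω, hω1, hω⟩ : ∃ ω : ℂ, ‖ω‖ = 1 ∧ ω * inner ℂ (S.g n') (S.g n) = c := by
    refine ⟨Complex.exp ((-(inner ℂ (S.g n') (S.g n)).arg : ℝ) * Complex.I),
      Complex.norm_exp_ofReal_mul_I _, ?_⟩
    rw [Complex.ofReal_neg, exp_neg_arg_mul_self, hc, corr, norm_inner_symm]
  set e := Complex.exp ((-S.θ : ℝ) * Complex.I) with he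
  have he1 : ‖e‖ = 1 := Complex.norm_exp_ofReal_mul_I _
  have hee : e * Complex.exp (S.θ * Complex.I) = 1 := by
    rw [he, ← Complex.exp_add]; simp
  have hm : 0 < 2 * (G - c) := by linarith
  have hp : 0 < 2 * (G + c) := by linarith
  set κ := √(2 * (G - c)) with hκ
  -- `κ` and `ν` are the norms of `a - b` and `a + b` below; dividing by them normalizes the noise.
  set ν := √(2 * (G + c)) with hν
  have hκ0 : 0 < κ := Real.sqrt_pos.2 hm
  have hν0 : 0 < ν := Real.sqrt_pos.2 hp
  have hκ2 : κ ^ 2 = 2 * (G - c) := Real.sq_sqrt hm.le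
  have hν2 : ν ^ 2 = 2 * (G + c) := Real.sq_sqrt hp.le
  have hδ : √(S.ρ * (G - c) / 2) = √S.ρ * (G - c) / κ := by
    rw [show S.ρ * (G - c) / 2 = (√S.ρ * (G - c) / κ) ^ 2 by
      rw [div_pow, mul_pow, Real.sq_sqrt S.ρ_pos.le, hκ2]; field_simp,
      Real.sqrt_sq (div_nonneg (mul_nonneg (Real.sqrt_nonneg _) (by linarith)) hκ0.le)]
  have hσ : √(S.ρ * (G + c) / 2) = √S.ρ * (G + c) / ν := by
    rw [show S.ρ * (G + c) / 2 = (√S.ρ * (G + c) / ν) ^ 2 by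
      rw [div_pow, mul_pow, Real.sq_sqrt S.ρ_pos.le, hν2]; field_simp,
      Real.sqrt_sq (div_nonneg (mul_nonneg (Real.sqrt_nonneg _) (by linarith)) hν0.le)]
  set a : Fin M → ℂ := fun i => conj (S.g n i) with ha
  set b : Fin M → ℂ := fun i => ω * conj (S.g n' i) with hb
  have sa : ∑ i, ‖a i‖ ^ 2 = G := by simp [ha, S.sum_norm_sq_g, hG]
  have sb : ∑ i, ‖b i‖ ^ 2 = G := by simp [hb, hω1, S.sum_norm_sq_g, hG]
  have sab : ∑ i, conj (a i) * b i = c := by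
    rw [← hω, PiLp.inner_apply, Finset.mul_sum]
    refine Finset.sum_congr rfl fun i _ => ?_
    simp only [ha, hb, Complex.conj_conj, RCLike.inner_apply]
    ring
  have sba : ∑ i, conj (b i) * a i = c := by
    have := congrArg conj sab
    simpa [mul_comm] using this
  have saa : ∑ i, conj (a i) * a i = G := by
    simp_rw [Complex.conj_mul', ← sa]; push_cast; rfl
  have sbb : ∑ i, conj (b i) * b i = G := by
    simp_rw [Complex.conj_mul', ← sb]; push_cast; rfl
  have sre : ∑ i, (a i * conj (b i)).re = c := by
    rw [← Complex.re_sum]; simp_rw [mul_comm (a _)]; rw [sba]; simp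
  have sφ : ∑ j, ‖conj (S.φ j)‖ ^ 2 = 1 := by simp [S.sum_norm_sq_φ]
  have s1 : ∑ i, ‖e / κ * (a i - b i)‖ ^ 2 = 1 := by
    have : ∀ i, ‖e / κ * (a i - b i)‖ ^ 2 =
        (‖a i‖ ^ 2 + ‖b i‖ ^ 2 - 2 * (a i * conj (b i)).re) / κ ^ 2 := by
      intro i
      rw [norm_mul, norm_div, he1, Complex.norm_real, Real.norm_of_nonneg hκ0.le, mul_pow,
        sub_eq_add_neg, norm_add_sq_eq, norm_neg, map_neg, mul_neg, Complex.neg_re]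
      ring
    simp_rw [this, ← Finset.sum_div, Finset.sum_sub_distrib, Finset.sum_add_distrib,
      ← Finset.mul_sum, sa, sb, sre]
    rw [div_eq_one_iff_eq (by positivity), hκ2]
    ring
  have s2 : ∑ i, ‖e / ν * (a i + b i)‖ ^ 2 = 1 := by
    have : ∀ i, ‖e / ν * (a i + b i)‖ ^ 2 =
        (‖a i‖ ^ 2 + ‖b i‖ ^ 2 + 2 * (a i * conj (b i)).re) / ν ^ 2 := by
      intro i
      rw [norm_mul, norm_div, he1, Complex.norm_real, Real.norm_of_nonneg hν0.le, mul_pow,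
        norm_add_sq_eq]
      ring
    simp_rw [this, ← Finset.sum_div, Finset.sum_add_distrib,
      ← Finset.mul_sum, sa, sb, sre]
    rw [div_eq_one_iff_eq (by positivity), hν2]
    ring
  have s3 : ∑ i, conj (e / κ * (a i - b i)) * (e / ν * (a i + b i)) = 0 := by
    have : ∀ i, conj (e / κ * (a i - b i)) * (e / ν * (a i + b i)) =
        conj (e / κ) * (e / ν) * (conj (a i) * a i + conj (a i) * b i - conj (b i) * a i -
          conj (b i) * b i) := by
      intro i
      rw [map_mul, map_sub]
      ring
    simp_rw [this, ← Finset.mul_sum, Finset.sum_sub_distrib, Finset.sum_add_distrib, saa, sab, sba,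
      sbb]
    ring
  have hmap := map_noiseLaw_eq_prod (fun i j => e / κ * (a i - b i) * conj (S.φ j))
    (fun i j => e / ν * (a i + b i) * conj (S.φ j))
    (by rw [sum_sum_norm_sq_mul, s1, sφ, one_mul]) (by rw [sum_sum_norm_sq_mul, s2, sφ, one_mul])
    (by rw [sum_sum_conj_mul, s3, zero_mul])
  rw [obtuseProb, ← hmap, map_measureReal_apply (by fun_prop)
    (measurableSet_lt (by fun_prop) (by fun_prop)), pairwiseErrorProb]
  congr 1
  ext W
  simp only [Set.mem_preimage, Set.mem_ofPred_eq]
  rw [concentratedLikelihood_lt_iff, matchedFilter_received, matchedFilter_received]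
  set x := ∑ i, ∑ j, conj (S.g n i * S.φ j) * W i j with hx
  set y := ∑ i, ∑ j, conj (S.g n' i * S.φ j) * W i j with hy
  have hU : ∑ i, ∑ j, e / κ * (a i - b i) * conj (S.φ j) * W i j = (e * x - e * ω * y) / κ := by
    simp_rw [hx, hy, Finset.mul_sum, ← Finset.sum_sub_distrib, Finset.sum_div]
    refine Finset.sum_congr rfl fun i _ => Finset.sum_congr rfl fun j _ => ?_
    simp only [ha, hb, map_mul]
    ring
  have hV : ∑ i, ∑ j, e / ν * (a i + b i) * conj (S.φ j) * W i j = (e * x + e * ω * y) / ν := by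
    simp_rw [hx, hy, Finset.mul_sum, ← Finset.sum_add_distrib, Finset.sum_div]
    refine Finset.sum_congr rfl fun i _ => Finset.sum_congr rfl fun j _ => ?_
    simp only [ha, hb, map_mul]
    ring
  have hgg : (inner ℂ (S.g n) (S.g n) : ℂ) = G := by
    rw [inner_self_eq_norm_sq_to_K, hG, ← S.norm_g n]; push_cast; rfl
  have hX : ‖√S.ρ * Complex.exp (S.θ * Complex.I) * inner ℂ (S.g n) (S.g n) + x‖ =
      ‖(√S.ρ * G : ℂ) + e * x‖ := by
    rw [← one_mul ‖_ + x‖, ← he1, ← norm_mul, hgg]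
    congr 1
    linear_combination √S.ρ * (G : ℂ) * hee
  have hY : ‖√S.ρ * Complex.exp (S.θ * Complex.I) * inner ℂ (S.g n') (S.g n) + y‖ =
      ‖(√S.ρ * c : ℂ) + e * ω * y‖ := by
    have : ‖e * ω‖ = 1 := by rw [norm_mul, he1, hω1, one_mul]
    rw [← one_mul ‖_ + y‖, ← this, ← norm_mul]
    congr 1
    linear_combination √S.ρ * (c : ℂ) * hee +
      √S.ρ * (e * Complex.exp (S.θ * Complex.I)) * hω
  rw [hU, hV, hX, hY, hδ, hσ, ← sq_lt_sq₀ (norm_nonneg _) (norm_nonneg _)]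
  set z := e * x
  set w := e * ω * y
  -- The positive factor `1 / (κ ν)` does not affect the sign, so the angle is obtuse exactly when
  -- `‖s‖² - ‖t‖²` is negative.
  have hfac : ((√S.ρ * (G - c) / κ : ℝ) + (z - w) / κ : ℂ) *
      conj ((√S.ρ * (G + c) / ν : ℝ) + (z + w) / ν : ℂ) =
      ((1 / (κ * ν) : ℝ) : ℂ) * (((√S.ρ * G + z) - (√S.ρ * c + w)) *
        conj ((√S.ρ * G + z) + (√S.ρ * c + w))) := by
    push_cast
    simp only [map_add, map_div₀, map_mul, Complex.conj_ofReal]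
    field_simp
    ring
  rw [hfac, Complex.re_ofReal_mul]
  have hk : 0 < 1 / (κ * ν) := by positivity
  have hdiff : ∀ s t : ℂ, ((s - t) * conj (s + t)).re = ‖s‖ ^ 2 - ‖t‖ ^ 2 := by
    intro s t
    simp only [← Complex.normSq_eq_norm_sq, Complex.normSq_apply, Complex.mul_re, Complex.conj_re,
      Complex.conj_im, Complex.add_re, Complex.add_im, Complex.sub_re, Complex.sub_im]
    ring
  rw [hdiff]
  exact sub_neg.symm.trans (smul_neg_iff_of_pos_left hk).symm

/-! ### From the system parameters to `δ` and `σ` -/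

theorem pairwiseErrorProb_lt {M' τ' N' : ℕ} (n n' : Fin N) (S' : GridOfBeams M' τ' N')
    (k k' : Fin N') (hdist : S.corr n n' < M * S.β)
    (hr : S'.corr k k' / (M' * S'.β) ≤ S.corr n n' / (M * S.β))
    (hs : S.sqrtSNR ≤ S'.sqrtSNR)
    (h : S'.corr k k' / (M' * S'.β) < S.corr n n' / (M * S.β) ∨ S.sqrtSNR < S'.sqrtSNR) :
    S'.pairwiseErrorProb k k' < S.pairwiseErrorProb n n' := by
  have hc : 0 ≤ S.corr n n' := norm_nonneg _
  have hc' : 0 ≤ S'.corr k k' := norm_nonneg _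
  have hρ := S.ρ_pos
  have hρ' := S'.ρ_pos
  have hG : 0 < M * S.β := hc.trans_lt hdist
  have hpos : 0 < S.ρ * M * S.β := by rw [mul_assoc]; positivity
  have hsq : S.ρ * M * S.β ≤ S'.ρ * M' * S'.β := by
    by_contra hcon
    push Not at hcon
    exact absurd (Real.sqrt_lt_sqrt_iff_of_pos hpos |>.2 hcon) (not_lt.2 hs)
  -- The case `M' = 0`, where the quotient would be `0` by convention, is excluded by the SNR
  -- hypothesis.
  have hG' : 0 < M' * S'.β := by
    have := hpos.trans_le hsq
    rw [mul_assoc] at this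
    exact pos_of_mul_pos_right this hρ'.le
  have hlt' : S'.sqrtSNR > S.sqrtSNR → S.ρ * M * S.β < S'.ρ * M' * S'.β := fun h =>
    lt_of_not_ge fun hcon => not_le.2 h (Real.sqrt_le_sqrt hcon)
  have hdist' : S'.corr k k' < M' * S'.β := by
    rw [← div_lt_one hG']
    exact hr.trans_lt ((div_lt_one hG).2 hdist)
  rw [div_le_div_iff₀ hG' hG] at hr
  rw [div_lt_div_iff₀ hG' hG] at h
  rw [S.pairwiseErrorProb_eq n n' hdist, S'.pairwiseErrorProb_eq k k' hdist']
  rw [mul_assoc, mul_assoc] at hsq hlt'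
  generalize (M : ℝ) * S.β = G at *
  generalize (M' : ℝ) * S'.β = G' at *
  generalize S.corr n n' = c at *
  generalize S'.corr k k' = c' at *
  generalize S.ρ = r at *
  generalize S'.ρ = r' at *
  have p1 : 0 < r * (G - c) / 2 := div_pos (mul_pos hρ (by linarith)) two_pos
  have p2 : 0 < r * (G + c) / 2 := div_pos (mul_pos hρ (by linarith)) two_pos
  have p3 : 0 < r' * (G' - c') / 2 := div_pos (mul_pos hρ' (by linarith)) two_pos
  have p4 : 0 < r' * (G' + c') / 2 := div_pos (mul_pos hρ' (by linarith)) two_pos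
  have hrr : 0 < r * r' := mul_pos hρ hρ'
  -- Clearing denominators, the comparison of correlation ratios becomes that of the squares of `σ
  -- δ'` and `σ' δ`.
  have hid : r * (G + c) / 2 * (r' * (G' - c') / 2) - r' * (G' + c') / 2 * (r * (G - c) / 2) =
      r * r' * (c * G' - c' * G) / 2 := by ring
  apply obtuseProb_lt (Real.sqrt_pos.2 p1) (Real.sqrt_le_sqrt (by nlinarith)) (Real.sqrt_pos.2 p3)
    (Real.sqrt_le_sqrt (by nlinarith))
  · rw [← Real.sqrt_mul p4.le, ← Real.sqrt_mul p2.le]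
    apply Real.sqrt_le_sqrt
    have := mul_nonneg hrr.le (sub_nonneg.2 hr)
    linarith
  · rw [Real.sq_sqrt p1.le, Real.sq_sqrt p2.le, Real.sq_sqrt p3.le, Real.sq_sqrt p4.le]
    linarith
  · refine h.imp (fun h => ?_) (fun h => ?_)
    · rw [← Real.sqrt_mul p4.le, ← Real.sqrt_mul p2.le]
      apply Real.sqrt_lt_sqrt (by positivity)
      have := mul_pos hrr (sub_pos.2 h)
      linarith
    · rw [Real.sq_sqrt p1.le, Real.sq_sqrt p2.le, Real.sq_sqrt p3.le, Real.sq_sqrt p4.le]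
      have := hlt' h
      linarith

end GridOfBeams

end

theorem proposition1 {M τ N M' τ' N' : ℕ}
    (S : GridOfBeams M τ N) (n n' : Fin N)
    (S' : GridOfBeams M' τ' N') (k k' : Fin N')
    (hdist : S.corr n n' < M * S.β) :
    -- smaller `|g_nᴴ g_{n'}|`, with `ρ` and the norm of the beams unchanged
    (S'.ρ = S.ρ → M' * S'.β = M * S.β → S'.corr k k' < S.corr n n' →
      S'.pairwiseErrorProb k k' < S.pairwiseErrorProb n n') ∧
    -- larger `√(ρ M β)`, with `|g_nᴴ g_{n'}|` unchanged and the norm of the beams not reduced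
    (S.sqrtSNR < S'.sqrtSNR → S'.corr k k' = S.corr n n' → M * S.β ≤ M' * S'.β →
      S'.pairwiseErrorProb k k' < S.pairwiseErrorProb n n') ∧
    -- both quantities varying, the correlation being measured relative to the norm of the beams
    (S'.corr k k' / (M' * S'.β) ≤ S.corr n n' / (M * S.β) → S.sqrtSNR ≤ S'.sqrtSNR →
      (S'.corr k k' / (M' * S'.β) < S.corr n n' / (M * S.β) ∨ S.sqrtSNR < S'.sqrtSNR) →
      S'.pairwiseErrorProb k k' < S.pairwiseErrorProb n n') := by
  have hG : 0 < M * S.β := (norm_nonneg _).trans_lt hdist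
  refine ⟨fun hρ hM hc => ?_, fun hs hc hM => ?_, S.pairwiseErrorProb_lt n n' S' k k' hdist⟩
  · have hr : S'.corr k k' / (M' * S'.β) < S.corr n n' / (M * S.β) := by
      rw [hM]
      exact div_lt_div_of_pos_right hc hG
    refine S.pairwiseErrorProb_lt n n' S' k k' hdist hr.le (le_of_eq ?_) (Or.inl hr)
    rw [GridOfBeams.sqrtSNR, GridOfBeams.sqrtSNR, mul_assoc, mul_assoc, hρ, hM]
  · refine S.pairwiseErrorProb_lt n n' S' k k' hdist ?_ hs.le (Or.inr hs)
    rw [hc]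
    exact div_le_div_of_nonneg_left (norm_nonneg _) hG hM
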